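/- A weight on $[0,\infty)$ is a non-decreasing, continuous, unbounded function $w:[0,\infty)\to(0,\infty)$ such that $\log r=o(\log w(r))$ as $r\to\infty$. For an entire function $f$ put $M_\infty(f,r)=\max_{0\le\theta<2\pi}|f(re^{i\theta})|$, and let $H_w^\infty(\mathbb{C})$ be the space of entire functions $f$ with $\|f\|_{H_w^\infty}=\sup_{r\ge 0}M_\infty(f,r)/w(r)<\infty$, with this norm. The associated weight of $w$ is $$\widetilde w(t)=\sup\{M_\infty(f,t):\ f\text{ entire},\ M_\infty(f,r)\le w(r)\text{ for all }r\ge 0\},\qquad t\ge 0,$$ and the integration operator $J$ is defined on entire functions by $Jf(z)=\int_0^z f(\zeta)\,d\zeta$, $z\in\mathbb{C}$. **Theorem.** Let $w,u$ be arbitrary weights on $[0,\infty)$. Then the following properties are equivalent: (i) $\displaystyle\lim_{r\to\infty}\frac{1}{u(r)}\int_0^r\widetilde w(t)\,dt=0$; (ii) $J$ maps $H_w^\infty(\mathbb{C})$ into $H_u^\infty(\mathbb{C})$, and $J:H_w^\infty(\mathbb{C})\to H_u^\infty(\mathbb{C})$ is a compact operator. -/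

import Mathlib

open Set Filter Topology

noncomputable section

/-- A weight on `[0, ∞)`: a positive, non-decreasing, continuous and unbounded function `w` with
`log r = o(log w(r))` as `r → ∞`. Only the values on `[0, ∞)` are relevant. -/
structure Weight where
  /-- the underlying function -/
  toFun : ℝ → ℝ
  pos' : ∀ r, 0 ≤ r → 0 < toFun r
  monotoneOn' : MonotoneOn toFun (Ici 0)
  continuousOn' : ContinuousOn toFun (Ici 0)
  unbounded' : ¬ BddAbove (toFun '' Ici 0)
  log_isLittleO' :
    Asymptotics.IsLittleO atTop (fun r : ℝ => Real.log r) (fun r : ℝ => Real.log (toFun r))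

instance : CoeFun Weight (fun _ => ℝ → ℝ) := ⟨Weight.toFun⟩

/-- `M_∞(f, r) = max_{0 ≤ θ < 2π} |f(r e^{iθ})|`. -/
def maxModulus (f : ℂ → ℂ) (r : ℝ) : ℝ :=
  ⨆ θ : Ico (0 : ℝ) (2 * Real.pi), ‖f ((r : ℂ) * Complex.exp (((θ : ℝ) : ℂ) * Complex.I))‖

/-- The associated weight
`w̃(t) = sup {M_∞(f, t) : f entire, M_∞(f, r) ≤ w(r) for all r ≥ 0}`. -/
def associatedWeight (w : Weight) (t : ℝ) : ℝ :=
  sSup {x : ℝ | ∃ f : ℂ → ℂ, Differentiable ℂ f ∧ (∀ r, 0 ≤ r → maxModulus f r ≤ w r) ∧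
    x = maxModulus f t}

lemma bddAbove_circle {f : ℂ → ℂ} (hf : Continuous f) (r : ℝ) :
    BddAbove (range fun θ : Ico (0 : ℝ) (2 * Real.pi) =>
      ‖f ((r : ℂ) * Complex.exp (((θ : ℝ) : ℂ) * Complex.I))‖) := by
  have hc : Continuous fun θ : ℝ => ‖f ((r : ℂ) * Complex.exp ((θ : ℂ) * Complex.I))‖ := by
    fun_prop
  obtain ⟨C, hC⟩ := (isCompact_Icc (a := (0 : ℝ)) (b := 2 * Real.pi)).bddAbove_image
    hc.continuousOn
  refine ⟨C, ?_⟩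
  rintro _ ⟨θ, rfl⟩
  exact hC ⟨θ, ⟨θ.2.1, θ.2.2.le⟩, rfl⟩

instance : Nonempty (Ico (0 : ℝ) (2 * Real.pi)) := ⟨⟨0, le_rfl, Real.two_pi_pos⟩⟩

lemma maxModulus_nonneg (f : ℂ → ℂ) (r : ℝ) : 0 ≤ maxModulus f r :=
  Real.iSup_nonneg fun _ => norm_nonneg _

lemma maxModulus_zero (r : ℝ) : maxModulus 0 r = 0 := by
  simp [maxModulus]

lemma maxModulus_add_le {f g : ℂ → ℂ} (hf : Continuous f) (hg : Continuous g) (r : ℝ) :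
    maxModulus (f + g) r ≤ maxModulus f r + maxModulus g r :=
  ciSup_le fun θ => (norm_add_le _ _).trans
    (add_le_add (le_ciSup (bddAbove_circle hf r) θ) (le_ciSup (bddAbove_circle hg r) θ))

lemma maxModulus_smul (c : ℂ) (f : ℂ → ℂ) (r : ℝ) :
    maxModulus (c • f) r = ‖c‖ * maxModulus f r := by
  simp only [maxModulus, Pi.smul_apply, norm_smul]
  exact (Real.mul_iSup_of_nonneg (norm_nonneg c) _).symm

lemma norm_le_maxModulus {f : ℂ → ℂ} (hf : Continuous f) (z : ℂ) :
    ‖f z‖ ≤ maxModulus f ‖z‖ := by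
  set θ := toIcoMod Real.two_pi_pos 0 z.arg with hθ
  have hmem : θ ∈ Ico (0 : ℝ) (2 * Real.pi) := by
    have := toIcoMod_mem_Ico Real.two_pi_pos 0 z.arg
    rwa [zero_add] at this
  have hz : ((‖z‖ : ℝ) : ℂ) * Complex.exp ((θ : ℂ) * Complex.I) = z := by
    have h1 : θ = z.arg - toIcoDiv Real.two_pi_pos 0 z.arg • (2 * Real.pi) := rfl
    rw [h1]
    have h2 : (((z.arg - toIcoDiv Real.two_pi_pos 0 z.arg • (2 * Real.pi) : ℝ) : ℂ)) * Complex.I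
        = (z.arg : ℂ) * Complex.I
          - (toIcoDiv Real.two_pi_pos 0 z.arg : ℂ) * (2 * Real.pi * Complex.I) := by
      push_cast [zsmul_eq_mul]
      ring
    rw [h2, Complex.exp_periodic.sub_int_mul_eq]
    exact Complex.norm_mul_exp_arg_mul_I z
  have h := le_ciSup (bddAbove_circle hf ‖z‖) ⟨θ, hmem⟩
  simp only [hz] at h
  exact h

/-- The entire functions `f` with `sup_{r ≥ 0} M_∞(f, r) / w(r) < ∞`, as a subspace of all
functions `ℂ → ℂ`. -/
def growthSubmodule (w : Weight) : Submodule ℂ (ℂ → ℂ) where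
  carrier := {f | Differentiable ℂ f ∧
    BddAbove (range fun r : Ici (0 : ℝ) => maxModulus f r / w r)}
  zero_mem' := ⟨differentiable_const 0, 0, by
    rintro _ ⟨r, rfl⟩
    simp [maxModulus_zero]⟩
  add_mem' := by
    rintro f g ⟨hf, C, hC⟩ ⟨hg, D, hD⟩
    refine ⟨hf.add hg, C + D, ?_⟩
    rintro _ ⟨r, rfl⟩
    refine le_trans ?_ (add_le_add (hC ⟨r, rfl⟩) (hD ⟨r, rfl⟩))
    dsimp only
    rw [← add_div]
    exact div_le_div_of_nonneg_right (maxModulus_add_le hf.continuous hg.continuous r)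
      (w.pos' r r.2).le
  smul_mem' := by
    rintro c f ⟨hf, C, hC⟩
    refine ⟨hf.const_smul c, ‖c‖ * C, ?_⟩
    rintro _ ⟨r, rfl⟩
    dsimp only
    rw [maxModulus_smul, mul_div_assoc]
    exact mul_le_mul_of_nonneg_left (hC ⟨r, rfl⟩) (norm_nonneg c)

/-- The growth space `H_w^∞(ℂ)`. It is a type of its own, so that it carries the topology of the
weighted norm below and not the topology of pointwise convergence. -/
def GrowthSpace (w : Weight) : Type := growthSubmodule w

namespace GrowthSpace

variable {w : Weight}

instance : AddCommGroup (GrowthSpace w) := inferInstanceAs (AddCommGroup (growthSubmodule w))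

instance : Module ℂ (GrowthSpace w) := inferInstanceAs (Module ℂ (growthSubmodule w))

/-- An element of `H_w^∞(ℂ)` as a function on `ℂ`. -/
def toFun (f : GrowthSpace w) : ℂ → ℂ := Subtype.val f

instance : CoeFun (GrowthSpace w) (fun _ => ℂ → ℂ) := ⟨toFun⟩

lemma differentiable (f : GrowthSpace w) : Differentiable ℂ f := (Subtype.property f).1

lemma bddAbove (f : GrowthSpace w) :
    BddAbove (range fun r : Ici (0 : ℝ) => maxModulus f r / w r) := (Subtype.property f).2

/-- `‖f‖ = sup_{r ≥ 0} M_∞(f, r) / w(r)`. -/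
instance : Norm (GrowthSpace w) := ⟨fun f => ⨆ r : Ici (0 : ℝ), maxModulus f r / w r⟩

lemma norm_def (f : GrowthSpace w) : ‖f‖ = ⨆ r : Ici (0 : ℝ), maxModulus f r / w r := rfl

lemma normedSpaceCore : NormedSpace.Core ℂ (GrowthSpace w) where
  norm_nonneg f := Real.iSup_nonneg fun r => div_nonneg (maxModulus_nonneg _ _) (w.pos' r r.2).le
  norm_smul c f := by
    have h : ∀ r : Ici (0 : ℝ),
        maxModulus (c • f : GrowthSpace w) r / w r = ‖c‖ * (maxModulus f r / w r) := fun r => by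
      rw [← mul_div_assoc, ← maxModulus_smul]
      rfl
    rw [norm_def, norm_def, Real.mul_iSup_of_nonneg (norm_nonneg c)]
    exact iSup_congr h
  norm_triangle f g := by
    refine ciSup_le fun r => ?_
    refine le_trans ?_ (add_le_add (le_ciSup f.bddAbove r) (le_ciSup g.bddAbove r))
    rw [← add_div]
    exact div_le_div_of_nonneg_right
      (maxModulus_add_le f.differentiable.continuous g.differentiable.continuous r)
      (w.pos' r r.2).le
  norm_eq_zero_iff f := by
    constructor
    · intro h
      apply Subtype.ext
      funext z
      have h1 : maxModulus f ‖z‖ / w ‖z‖ ≤ 0 :=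
        (le_ciSup f.bddAbove (⟨‖z‖, norm_nonneg z⟩ : Ici (0 : ℝ))).trans h.le
      have h2 : maxModulus f ‖z‖ ≤ 0 := by
        have := (div_le_iff₀ (w.pos' _ (norm_nonneg z))).1 h1
        rwa [zero_mul] at this
      exact norm_le_zero_iff.1 ((norm_le_maxModulus f.differentiable.continuous z).trans h2)
    · rintro rfl
      have h : ∀ r : Ici (0 : ℝ), maxModulus (0 : GrowthSpace w) r / w r = 0 := fun r => by
        have : maxModulus (0 : GrowthSpace w) r = 0 := maxModulus_zero r
        rw [this, zero_div]
      rw [norm_def, iSup_congr h]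
      simp

instance : NormedAddCommGroup (GrowthSpace w) := NormedAddCommGroup.ofCore normedSpaceCore

instance : NormedSpace ℂ (GrowthSpace w) := NormedSpace.ofCore normedSpaceCore

end GrowthSpace

/-- The integration operator `(J f)(z) = ∫_0^z f(ζ) dζ`, the integral being taken along the
segment `ζ = t z`, `0 ≤ t ≤ 1`. -/
def integrationOp (f : ℂ → ℂ) (z : ℂ) : ℂ :=
  ∫ t in (0 : ℝ)..1, f ((t : ℂ) * z) * z

end

/-! ### Maximum modulus, associated weight and integration along segments. -/

section Basics

/-! Sufficiency: if `f` lies in the unit ball of the source space, then `|Jf(z)|` is at most the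
integral of the associated weight over `[0, |z|]`. Condition (i) thus makes `J` bounded and `|Jf| /
u` small near infinity, uniformly over the ball. On a fixed disc, Montel's theorem supplies
uniformly convergent subsequences, and the two estimates together give convergence in the norm of
the target.

Necessity: the key is one power series `g(r) = ∑ d k * r ^ k` with `d k ≥ 0` that majorises the
associated weight up to a constant and is itself at most a constant times `w`
(`exists_powerSeries_comparable`). The tails of `g` are bounded in the source space and their images
under `J` tend to zero pointwise, so compactness makes some image small in norm. On the positive
axis, the integral of the associated weight is then at most a polynomial plus a small multiple of
`u`, and polynomials are `o(u)`.

To build `g`, let `w.coeff k` be the largest `c` with `c * r ^ k ≤ w r` for all `r ≥ 0`; this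
sequence is log-concave. Maximum principle and Cauchy estimates bound the associated weight by four
times the maximal term `max_k w.coeff k * r ^ k` (`IsDominated.exists_maxModulus_le`). The full
series may be much larger than its maximal term, so a greedy choice of exponents (`exists_lacunary`)
keeps just enough terms to recover the maximal term up to a factor two, while the kept terms decay
geometrically away from the peak. -/

lemma maxModulus_le_iff {f : ℂ → ℂ} (hf : Continuous f) {r C : ℝ} (hr : 0 ≤ r) :
    maxModulus f r ≤ C ↔ ∀ z : ℂ, ‖z‖ = r → ‖f z‖ ≤ C := by
  constructor
  · rintro h z rfl
    exact (norm_le_maxModulus hf z).trans h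
  · intro h
    refine ciSup_le fun θ => h _ ?_
    rw [norm_mul, Complex.norm_exp_ofReal_mul_I, mul_one, Complex.norm_real, Real.norm_of_nonneg hr]

lemma norm_le_of_sphere_le {f : ℂ → ℂ} (hf : Differentiable ℂ f) {R C : ℝ}
    (h : ∀ z : ℂ, ‖z‖ = R → ‖f z‖ ≤ C) {z : ℂ} (hz : ‖z‖ ≤ R) : ‖f z‖ ≤ C := by
  rcases hz.eq_or_lt with hz' | hz'
  · exact h z hz'
  · have hR : R ≠ 0 := ((norm_nonneg z).trans_lt hz').ne'
    refine Complex.norm_le_of_forall_mem_frontier_norm_le (U := Metric.ball 0 R)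
      Metric.isBounded_ball hf.diffContOnCl (fun y hy => ?_) (subset_closure (by simpa using hz'))
    rw [frontier_ball _ hR] at hy
    exact h y (by simpa using hy)

lemma maxModulus_mono {f : ℂ → ℂ} (hf : Differentiable ℂ f) {r s : ℝ} (hr : 0 ≤ r) (hrs : r ≤ s) :
    maxModulus f r ≤ maxModulus f s := by
  refine (maxModulus_le_iff hf.continuous hr).2 fun z hz => ?_
  exact norm_le_of_sphere_le hf ((maxModulus_le_iff hf.continuous (hr.trans hrs)).1 le_rfl)
    (hz.le.trans hrs)

lemma Weight.tendsto_atTop (w : Weight) : Tendsto w atTop atTop := by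
  refine Filter.tendsto_atTop.2 fun b => ?_
  have := w.unbounded'
  rw [not_bddAbove_iff] at this
  obtain ⟨_, ⟨r, hr, rfl⟩, hb⟩ := this b
  filter_upwards [eventually_ge_atTop r] with s hs
  exact hb.le.trans (w.monotoneOn' hr (mem_Ici.2 (le_trans hr hs)) hs)

/-- The growth condition gives `(k + 1) * log r ≤ log (w r)` eventually, and the spare power of `r`
forces the limit. -/
lemma Weight.tendsto_pow_div (w : Weight) (k : ℕ) :
    Tendsto (fun r : ℝ => r ^ k / w r) atTop (𝓝 0) := by
  have h1 := w.log_isLittleO'.bound (c := 1 / ((k : ℝ) + 1)) (by positivity)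
  refine squeeze_zero' (g := fun r : ℝ => r⁻¹) ?_ ?_ tendsto_inv_atTop_zero
  · filter_upwards [eventually_ge_atTop (0 : ℝ)] with r hr
    have := w.pos' r hr
    positivity
  · filter_upwards [h1, eventually_ge_atTop (1 : ℝ), w.tendsto_atTop.eventually_ge_atTop 1]
      with r h hr hw
    rw [Real.norm_of_nonneg (Real.log_nonneg hr), Real.norm_of_nonneg (Real.log_nonneg hw),
      one_div, ← div_eq_inv_mul, le_div_iff₀ (by positivity)] at h
    have h2 : Real.log (r ^ (k + 1)) ≤ Real.log (w r) := by
      rw [Real.log_pow]; push_cast; linarith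
    have h3 : r ^ (k + 1) ≤ w r := (Real.log_le_log_iff (by positivity) (by linarith)).1 h2
    rw [div_le_iff₀ (by linarith), ← div_eq_inv_mul, le_div_iff₀ (by linarith), ← pow_succ]
    exact h3

/-- `f` is entire and `‖f z‖ ≤ w ‖z‖`. -/
def IsDominated (w : Weight) (f : ℂ → ℂ) : Prop :=
  Differentiable ℂ f ∧ ∀ z, ‖f z‖ ≤ w ‖z‖

lemma isDominated_iff {w : Weight} {f : ℂ → ℂ} :
    IsDominated w f ↔ Differentiable ℂ f ∧ ∀ r, 0 ≤ r → maxModulus f r ≤ w r := by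
  refine and_congr_right fun hf => ⟨fun h r hr => ?_, fun h z => ?_⟩
  · exact (maxModulus_le_iff hf.continuous hr).2 fun z hz => hz ▸ h z
  · exact (norm_le_maxModulus hf.continuous z).trans (h _ (norm_nonneg z))

lemma maxModulus_le_associatedWeight {w : Weight} {f : ℂ → ℂ} (hf : IsDominated w f) {t : ℝ}
    (ht : 0 ≤ t) : maxModulus f t ≤ associatedWeight w t := by
  rw [isDominated_iff] at hf
  refine le_csSup ⟨w t, ?_⟩ ⟨f, hf.1, hf.2, rfl⟩
  rintro _ ⟨g, -, hg, rfl⟩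
  exact hg t ht

lemma norm_le_associatedWeight {w : Weight} {f : ℂ → ℂ} (hf : IsDominated w f) (z : ℂ) :
    ‖f z‖ ≤ associatedWeight w ‖z‖ :=
  (norm_le_maxModulus hf.1.continuous z).trans
    (maxModulus_le_associatedWeight hf (norm_nonneg z))

lemma isDominated_zero (w : Weight) : IsDominated w 0 :=
  ⟨differentiable_const 0, fun z => by simpa using (w.pos' _ (norm_nonneg z)).le⟩

lemma associatedWeight_le {w : Weight} {t C : ℝ}
    (h : ∀ f, IsDominated w f → maxModulus f t ≤ C) : associatedWeight w t ≤ C := by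
  refine csSup_le ⟨_, 0, (isDominated_iff.1 (isDominated_zero w)).1,
    (isDominated_iff.1 (isDominated_zero w)).2, rfl⟩ ?_
  rintro _ ⟨f, hf, hfw, rfl⟩
  exact h f (isDominated_iff.2 ⟨hf, hfw⟩)

lemma associatedWeight_nonneg (w : Weight) {t : ℝ} (ht : 0 ≤ t) : 0 ≤ associatedWeight w t :=
  (maxModulus_nonneg 0 t).trans (maxModulus_le_associatedWeight (isDominated_zero w) ht)

lemma associatedWeight_monotoneOn (w : Weight) : MonotoneOn (associatedWeight w) (Ici 0) :=
  fun _ hs _ ht hst => associatedWeight_le fun _ hf => (maxModulus_mono hf.1 hs hst).trans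
    (maxModulus_le_associatedWeight hf ht)

/-- The maximum principle makes the associated weight monotone, so no continuity is needed. -/
lemma associatedWeight_intervalIntegrable (w : Weight) {a b : ℝ} (ha : 0 ≤ a) (hb : 0 ≤ b) :
    IntervalIntegrable (associatedWeight w) MeasureTheory.volume a b :=
  ((associatedWeight_monotoneOn w).mono fun _ hx =>
    (le_min ha hb).trans hx.1).intervalIntegrable

lemma IsDominated.smul {w : Weight} {f : ℂ → ℂ} (hf : Differentiable ℂ f) {c : ℝ} (hc : 0 < c)
    (h : ∀ z, ‖f z‖ ≤ c * w ‖z‖) : IsDominated w (((c : ℂ)⁻¹) • f) := by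
  refine ⟨hf.const_smul _, fun z => ?_⟩
  rw [Pi.smul_apply, norm_smul, norm_inv, Complex.norm_real, Real.norm_of_nonneg hc.le,
    inv_mul_le_iff₀ hc]
  exact h z

namespace GrowthSpace

variable {w : Weight}

lemma mem_growthSubmodule {f : ℂ → ℂ} (hf : Differentiable ℂ f) {C : ℝ}
    (h : ∀ z, ‖f z‖ ≤ C * w ‖z‖) : f ∈ growthSubmodule w := by
  refine ⟨hf, C, ?_⟩
  rintro _ ⟨⟨r, hr⟩, rfl⟩
  rw [div_le_iff₀ (w.pos' r hr)]
  exact (maxModulus_le_iff hf.continuous hr).2 fun z hz => hz ▸ h z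

lemma norm_apply_le (f : GrowthSpace w) (z : ℂ) : ‖f z‖ ≤ ‖f‖ * w ‖z‖ := by
  refine (norm_le_maxModulus f.differentiable.continuous z).trans ?_
  rw [← div_le_iff₀ (w.pos' _ (norm_nonneg z))]
  exact le_ciSup f.bddAbove (⟨‖z‖, norm_nonneg z⟩ : Ici (0 : ℝ))

lemma norm_le_of_forall {f : GrowthSpace w} {C : ℝ} (h : ∀ z, ‖f z‖ ≤ C * w ‖z‖) : ‖f‖ ≤ C := by
  refine ciSup_le fun r => ?_
  rw [div_le_iff₀ (w.pos' r r.2)]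
  exact (maxModulus_le_iff f.differentiable.continuous r.2).2 fun z hz => hz ▸ h z

/-- The element of the growth space given by an entire function with a growth bound. -/
def mk (f : ℂ → ℂ) (hf : f ∈ growthSubmodule w) : GrowthSpace w := ⟨f, hf⟩

lemma ext {f g : GrowthSpace w} (h : ∀ z, f z = g z) : f = g := Subtype.ext (funext h)

lemma isDominated {f : GrowthSpace w} (hf : ‖f‖ ≤ 1) : IsDominated w f :=
  ⟨f.differentiable, fun z => (f.norm_apply_le z).trans
    ((mul_le_mul_of_nonneg_right hf (w.pos' _ (norm_nonneg z)).le).trans_eq (one_mul _))⟩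

end GrowthSpace

/-- An entire function has a primitive vanishing at the origin; the segment integral recovers it. -/
lemma hasDerivAt_integrationOp {f : ℂ → ℂ} (hf : Differentiable ℂ f) (z : ℂ) :
    HasDerivAt (integrationOp f) (f z) z := by
  obtain ⟨F, hF0, hF⟩ := hf.isExactOn_univ.with_val_at 0 0
  have h : integrationOp f = F := by
    funext z
    have h1 : ∀ t ∈ uIcc (0 : ℝ) 1, HasDerivAt (fun t : ℝ => F ((t : ℂ) * z)) (f (t * z) * z) t := by
      intro t _
      have h2 : HasDerivAt (fun t : ℝ => (t : ℂ) * z) z t := by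
        simpa using (Complex.ofRealCLM.hasDerivAt (x := t)).mul_const z
      exact (hF (t * z) (mem_univ _)).comp t h2
    rw [integrationOp, intervalIntegral.integral_eq_sub_of_hasDerivAt h1]
    · simp [hF0]
    · have := hf.continuous
      exact Continuous.intervalIntegrable (by fun_prop) _ _
  rw [h]
  exact hF z (mem_univ z)

lemma norm_integrationOp_le {f : ℂ → ℂ} {g : ℝ → ℝ} (z : ℂ)
    (hg : IntervalIntegrable g MeasureTheory.volume 0 ‖z‖)
    (h : ∀ y, ‖y‖ ≤ ‖z‖ → ‖f y‖ ≤ g ‖y‖) :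
    ‖integrationOp f z‖ ≤ ∫ t in (0 : ℝ)..‖z‖, g t := by
  have h0 : (∫ t in (0 : ℝ)..1, ‖z‖ * g (‖z‖ * t)) = ∫ t in (0 : ℝ)..‖z‖, g t := by
    rw [intervalIntegral.integral_const_mul, intervalIntegral.mul_integral_comp_mul_left]
    simp
  rw [← h0]
  have hi : IntervalIntegrable (fun t => ‖z‖ * g (‖z‖ * t)) MeasureTheory.volume 0 1 := by
    rcases eq_or_ne ‖z‖ 0 with hz | hz
    · simp [hz]
    · have := (hg.comp_mul_left (c := ‖z‖)).const_mul ‖z‖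
      simpa [hz] using this
  refine intervalIntegral.norm_integral_le_of_norm_le zero_le_one (MeasureTheory.ae_of_all _ fun t ht => ?_) hi
  have hn : ‖(t : ℂ) * z‖ = ‖z‖ * t := by
    rw [norm_mul, Complex.norm_real, Real.norm_of_nonneg ht.1.le, mul_comm]
  rw [norm_mul, mul_comm, ← hn]
  refine mul_le_mul_of_nonneg_left (h _ ?_) (norm_nonneg z)
  rw [hn]
  exact mul_le_of_le_one_right (norm_nonneg z) ht.2

lemma integrationOp_ofReal (f : ℂ → ℂ) (r : ℝ) :
    integrationOp f r = ∫ t in (0 : ℝ)..r, f t := by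
  have h := intervalIntegral.smul_integral_comp_mul_left (a := 0) (b := 1)
    (fun t : ℝ => f t) r
  rw [mul_zero, mul_one] at h
  rw [← h, integrationOp, intervalIntegral.integral_mul_const, mul_comm]
  simp [mul_comm]

lemma integrationOp_add {f g : ℂ → ℂ} (hf : Continuous f) (hg : Continuous g) (z : ℂ) :
    integrationOp (fun y => f y + g y) z = integrationOp f z + integrationOp g z := by
  simp only [integrationOp, add_mul]
  exact intervalIntegral.integral_add (Continuous.intervalIntegrable (by fun_prop) _ _)
    (Continuous.intervalIntegrable (by fun_prop) _ _)

lemma integrationOp_const_mul (c : ℂ) (f : ℂ → ℂ) (z : ℂ) :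
    integrationOp (fun y => c * f y) z = c * integrationOp f z := by
  simp only [integrationOp, mul_assoc]
  exact intervalIntegral.integral_const_mul _ _

end Basics

/-! ### Lacunary subseries of log-concave power series. -/

section Sparse

/-- Every term of `A j * r ^ j` between the indices `k` and `l` is dominated by the two end terms. -/
def EndpointDominated (A : ℕ → ℝ) (k l : ℕ) : Prop :=
  ∀ r : ℝ, 0 ≤ r → ∀ j, k ≤ j → j ≤ l → A j * r ^ j ≤ 2 * max (A k * r ^ k) (A l * r ^ l)

lemma endpointDominated_succ {A : ℕ → ℝ} (hA : ∀ k, 0 < A k) (k : ℕ) :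
    EndpointDominated A k (k + 1) := by
  intro r hr j hj1 hj2
  have h1 : 0 ≤ A k * r ^ k := mul_nonneg (hA k).le (pow_nonneg hr k)
  have h2 : 0 ≤ max (A k * r ^ k) (A (k + 1) * r ^ (k + 1)) := h1.trans (le_max_left _ _)
  obtain rfl | rfl : j = k ∨ j = k + 1 := by omega
  · linarith [le_max_left (A j * r ^ j) (A (j + 1) * r ^ (j + 1))]
  · linarith [le_max_right (A k * r ^ k) (A (k + 1) * r ^ (k + 1))]

lemma eventually_not_endpointDominated {A : ℕ → ℝ} (hA : ∀ k, 0 < A k)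
    (h0 : ∀ r : ℝ, 0 ≤ r → Tendsto (fun k => A k * r ^ k) atTop (𝓝 0)) (k : ℕ) :
    ∀ᶠ l in atTop, ¬ EndpointDominated A k l := by
  have hk := hA k
  have hk1 := hA (k + 1)
  -- At this radius term `k + 1` is three times term `k`, beating the factor two, while term `l` is
  -- below term `k` for large `l`.
  set r : ℝ := 3 * A k / A (k + 1) with hr
  have hr0 : 0 < r := by positivity
  have hpos : 0 < A k * r ^ k := by positivity
  filter_upwards [(h0 r hr0.le).eventually_lt_const hpos, eventually_ge_atTop (k + 1)]
    with l hl hkl h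
  have h1 := h r hr0.le (k + 1) (by omega) hkl
  rw [max_eq_left hl.le] at h1
  have h2 : A (k + 1) * r ^ (k + 1) = 3 * (A k * r ^ k) := by
    rw [pow_succ]
    nth_rewrite 2 [hr]
    field_simp
  linarith

lemma exists_maximal_endpointDominated {A : ℕ → ℝ} (hA : ∀ k, 0 < A k)
    (h0 : ∀ r : ℝ, 0 ≤ r → Tendsto (fun k => A k * r ^ k) atTop (𝓝 0)) (k : ℕ) :
    ∃ l, k < l ∧ EndpointDominated A k l ∧ ¬ EndpointDominated A k (l + 1) := by
  by_contra! h
  have h1 : ∀ m, EndpointDominated A k (k + 1 + m) := by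
    intro m
    induction m with
    | zero => exact endpointDominated_succ hA k
    | succ m ih => exact h _ (Nat.lt_add_right m k.lt_succ_self) ih
  obtain ⟨l, hl, hkl⟩ := ((eventually_not_endpointDominated hA h0 k).and
    (eventually_ge_atTop (k + 1))).exists
  obtain ⟨m, rfl⟩ := Nat.exists_eq_add_of_le hkl
  exact hl (h1 m)

lemma sum_le_of_le_half_succ_succ {a : ℕ → ℝ} {M : ℝ} (hM : ∀ i, a i ≤ M) (ha : ∀ i, 0 ≤ a i)
    {N : ℕ} (h : ∀ i, i + 2 < N → a i ≤ a (i + 2) / 2) :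
    ∑ i ∈ Finset.range N, a i ≤ 4 * M := by
  have h0 : 0 ≤ M := (ha 0).trans (hM 0)
  -- The induction absorbs `2 * a m ≤ a (m + 2)`. For `m ≤ 1` truncated subtraction makes both
  -- indices `0`.
  have key : ∀ m ≤ N, ∑ i ∈ Finset.range m, a i ≤ 2 * a (m - 1) + 2 * a (m - 2) := by
    intro m
    induction m with
    | zero => intro _; simpa using add_nonneg (ha 0) (ha 0)
    | succ m ih =>
      intro hm
      rcases m with _ | _ | m
      · simp; linarith [ha 0]
      · simp [Finset.sum_range_succ]; linarith [ha 0, ha 1]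
      · rw [Finset.sum_range_succ]
        have := ih (by omega)
        have h2 := h m (by omega)
        simp only [Nat.add_sub_cancel, Nat.reduceSubDiff] at this ⊢
        linarith
  linarith [key N le_rfl, hM (N - 1), hM (N - 2)]

lemma sum_le_of_succ_succ_le_half {a : ℕ → ℝ} {M : ℝ} (hM : ∀ i, a i ≤ M) (ha : ∀ i, 0 ≤ a i)
    (h : ∀ i, a (i + 2) ≤ a i / 2) (N : ℕ) :
    ∑ i ∈ Finset.range N, a i ≤ 4 * M := by
  -- The left side is non-increasing in `m`: the halving hypothesis pays for each new term.
  have key : ∀ m, ∑ i ∈ Finset.range m, a i + 2 * a m + 2 * a (m + 1) ≤ 4 * M := by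
    intro m
    induction m with
    | zero => simp; linarith [hM 0, hM 1]
    | succ m ih =>
      rw [Finset.sum_range_succ]
      linarith [h m]
  linarith [key N, ha N, ha (N + 1)]

/-- For a log-concave sequence `A`, the terms `A k * r ^ k` increase up to some index and decrease
afterwards. -/
lemma exists_unimodal {A : ℕ → ℝ} (hA : ∀ k, 0 < A k)
    (hlc : ∀ k, A k * A (k + 2) ≤ A (k + 1) ^ 2)
    (h0 : ∀ r : ℝ, 0 ≤ r → Tendsto (fun k => A k * r ^ k) atTop (𝓝 0)) {r : ℝ} (hr : 0 ≤ r) :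
    ∃ K, (∀ i j, i ≤ j → j ≤ K → A i * r ^ i ≤ A j * r ^ j) ∧
      ∀ i j, K ≤ i → i ≤ j → A j * r ^ j ≤ A i * r ^ i := by
  rcases hr.eq_or_lt with rfl | hr
  · refine ⟨0, fun i j hij hj => ?_, fun i j _ hij => ?_⟩
    · obtain rfl : i = j := by omega
      rfl
    · rcases j with _ | j
      · obtain rfl : i = 0 := by omega
        rfl
      · have := (hA i).le
        simp only [ne_eq, Nat.add_eq_zero_iff, one_ne_zero, and_false, not_false_eq_true, zero_pow,
          mul_zero]
        positivity
  -- Log-concavity makes the ratios `A (k + 1) / A k` non-increasing; the peak is the first index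
  -- where this ratio times `r` drops below one.
  have hdec : ∀ k, A (k + 1) * r < A k → A (k + 2) * r < A (k + 1) := by
    intro k hk
    have h1 := hlc k
    have h2 := hA k
    have h3 := hA (k + 1)
    have h4 := hA (k + 2)
    by_contra! hcon
    nlinarith [mul_lt_mul'' hk (lt_of_lt_of_le (lt_add_one _) le_rfl) (by positivity) h3.le,
      mul_le_mul hcon hk.le (by positivity) (by positivity)]
  have hex : ∃ k, A (k + 1) * r < A k := by
    by_contra! hcon
    have hm : Monotone fun k => A k * r ^ k := by
      refine monotone_nat_of_le_succ fun k => ?_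
      rw [pow_succ, mul_comm (r ^ k), ← mul_assoc]
      exact mul_le_mul_of_nonneg_right (hcon k) (by positivity)
    have := hm.ge_of_tendsto (h0 r hr.le) 0
    simp only [pow_zero, mul_one] at this
    linarith [hA 0]
  classical
  refine ⟨Nat.find hex, fun i j hij => ?_, fun i j hi hij => ?_⟩
  · induction j, hij using Nat.le_induction with
    | base => intro _; rfl
    | succ j hij ih =>
      intro hj
      refine (ih (by omega)).trans ?_
      have := Nat.find_min hex (m := j) (by omega)
      rw [pow_succ, mul_comm (r ^ j), ← mul_assoc]
      exact mul_le_mul_of_nonneg_right (not_lt.1 this) (by positivity)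
  · have hall : ∀ k, Nat.find hex ≤ k → A (k + 1) * r < A k := by
      intro k hk
      induction k, hk using Nat.le_induction with
      | base => exact Nat.find_spec hex
      | succ k hk ih => exact hdec k ih
    induction j, hij using Nat.le_induction with
    | base => rfl
    | succ j hij ih =>
      refine le_trans ?_ ih
      rw [pow_succ, mul_comm (r ^ j), ← mul_assoc]
      exact mul_le_mul_of_nonneg_right (hall j (by omega)).le (by positivity)

/-- The ratio of the higher monomial to the lower one grows with the radius, so a factor-two gap at
`ρ` persists on the appropriate side of `ρ`. -/
lemma mul_pow_le_half_of_le {a b r ρ : ℝ} {i j : ℕ} (hij : i ≤ j) (hb : 0 ≤ b) (hρ : 0 < ρ)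
    (hr : ρ ≤ r) (h : 2 * (a * ρ ^ i) ≤ b * ρ ^ j) : a * r ^ i ≤ b * r ^ j / 2 := by
  obtain ⟨m, rfl⟩ := Nat.exists_eq_add_of_le hij
  have hi : 0 < ρ ^ i := by positivity
  have h1 : 2 * a ≤ b * ρ ^ m := by
    rw [pow_add] at h
    refine le_of_mul_le_mul_right ?_ hi
    linarith
  have h2 : ρ ^ m ≤ r ^ m := pow_le_pow_left₀ hρ.le hr m
  have h3 : 2 * a ≤ b * r ^ m := h1.trans (mul_le_mul_of_nonneg_left h2 hb)
  have h4 : 0 ≤ r ^ i := pow_nonneg (hρ.le.trans hr) i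
  rw [pow_add]
  nlinarith [mul_le_mul_of_nonneg_right h3 h4]

lemma mul_pow_le_half_of_ge {a b r ρ : ℝ} {i j : ℕ} (hij : i ≤ j) (hb : 0 ≤ b) (hρ : 0 < ρ)
    (hr0 : 0 ≤ r) (hr : r ≤ ρ) (h : 2 * (b * ρ ^ j) ≤ a * ρ ^ i) :
    b * r ^ j ≤ a * r ^ i / 2 := by
  obtain ⟨m, rfl⟩ := Nat.exists_eq_add_of_le hij
  have hi : 0 < ρ ^ i := by positivity
  have h1 : 2 * (b * ρ ^ m) ≤ a := by
    rw [pow_add] at h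
    refine le_of_mul_le_mul_right ?_ hi
    linarith
  have h2 : r ^ m ≤ ρ ^ m := pow_le_pow_left₀ hr0 hr m
  have h3 : 2 * (b * r ^ m) ≤ a := by linarith [mul_le_mul_of_nonneg_left h2 hb]
  have h4 : 0 ≤ r ^ i := pow_nonneg hr0 i
  rw [pow_add]
  nlinarith [mul_le_mul_of_nonneg_right h3 h4]

/-- A log-concave power series with positive coefficients has a lacunary subseries which is
comparable with its maximal term. -/
lemma exists_lacunary {A : ℕ → ℝ} (hA : ∀ k, 0 < A k)
    (hlc : ∀ k, A k * A (k + 2) ≤ A (k + 1) ^ 2)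
    (h0 : ∀ r : ℝ, 0 ≤ r → Tendsto (fun k => A k * r ^ k) atTop (𝓝 0)) :
    ∃ n : ℕ → ℕ, StrictMono n ∧
      (∀ r : ℝ, 0 ≤ r → ∀ j, ∃ i, A j * r ^ j ≤ 2 * (A (n i) * r ^ n i)) ∧
      ∀ r : ℝ, 0 ≤ r → ∃ K, ∀ N, ∑ i ∈ Finset.range N, A (n i) * r ^ n i ≤ 8 * (A K * r ^ K) := by
  choose next hlt hdom hnot using exists_maximal_endpointDominated hA h0
  let n : ℕ → ℕ := fun i => next^[i] 0
  have hn : ∀ i, n (i + 1) = next (n i) := fun i => Function.iterate_succ_apply' next i 0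
  have hn0 : n 0 = 0 := rfl
  have hmono : StrictMono n := strictMono_nat_of_lt_succ fun i => by rw [hn]; exact hlt _
  have hloc : ∀ j, ∃ i, n i ≤ j ∧ j < n (i + 1) := by
    intro j
    have hex : ∃ i, j < n i := ⟨j + 1, hmono.le_apply⟩
    classical
    obtain ⟨i, hi⟩ : ∃ i, Nat.find hex = i + 1 := by
      refine Nat.exists_eq_succ_of_ne_zero fun h => ?_
      have := Nat.find_spec hex
      rw [h] at this
      omega
    refine ⟨i, not_lt.1 (Nat.find_min hex (by omega)), ?_⟩
    rw [← hi]
    exact Nat.find_spec hex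
  refine ⟨n, hmono, fun r hr j => ?_, fun r hr => ?_⟩
  · obtain ⟨i, hi1, hi2⟩ := hloc j
    have := hdom (n i) r hr j hi1 (by rw [← hn]; exact hi2.le)
    rw [← hn] at this
    rcases le_total (A (n i) * r ^ n i) (A (n (i + 1)) * r ^ n (i + 1)) with h | h
    · exact ⟨i + 1, by rwa [max_eq_right h] at this⟩
    · exact ⟨i, by rwa [max_eq_left h] at this⟩
  · obtain ⟨K, hinc, hdecr⟩ := exists_unimodal hA hlc h0 hr
    have hmax : ∀ i, A i * r ^ i ≤ A K * r ^ K := fun i =>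
      (le_total i K).elim (fun h => hinc i K h le_rfl) (fun h => hdecr K i le_rfl h)
    have hnn : ∀ i, 0 ≤ A i * r ^ i := fun i => mul_nonneg (hA i).le (pow_nonneg hr i)
    -- Maximality of the greedy step: extended by one index, domination fails, so at some `ρ` an
    -- intermediate term exceeds twice both end terms.
    have hcross : ∀ i, ∃ ρ j, 0 < ρ ∧ n i ≤ j ∧ j ≤ n (i + 1) + 1 ∧
        2 * (A (n i) * ρ ^ n i) ≤ A j * ρ ^ j ∧
        2 * (A (n (i + 1) + 1) * ρ ^ (n (i + 1) + 1)) ≤ A j * ρ ^ j := by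
      intro i
      have := hnot (n i)
      rw [← hn] at this
      simp only [EndpointDominated, not_forall, not_le] at this
      obtain ⟨ρ, hρ, j, h1, h2, h3⟩ := this
      have hk := le_max_left (A (n i) * ρ ^ n i) (A (n (i + 1) + 1) * ρ ^ (n (i + 1) + 1))
      have hl := le_max_right (A (n i) * ρ ^ n i) (A (n (i + 1) + 1) * ρ ^ (n (i + 1) + 1))
      refine ⟨ρ, j, hρ.lt_of_ne ?_, h1, h2, by linarith, by linarith⟩
      rintro rfl
      have hpos : 0 ≤ A (n i) * 0 ^ n i := mul_nonneg (hA _).le (pow_nonneg le_rfl _)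
      rcases Nat.eq_zero_or_pos j with rfl | hj
      · obtain h : n i = 0 := by omega
        rw [h] at hk h3
        simp only [pow_zero, mul_one] at hk h3
        linarith [hA 0]
      · rw [zero_pow hj.ne'] at h3
        linarith
    obtain ⟨I, hI1, hI2⟩ := hloc K
    have hleft : ∀ i, i + 2 < I + 1 → A (n i) * r ^ n i ≤ A (n (i + 2)) * r ^ n (i + 2) / 2 := by
      intro i hi
      obtain ⟨ρ, j, hρ, h1, h2, h3, h4⟩ := hcross i
      have hj : n (i + 1) + 1 ≤ n (i + 2) := hmono (by omega : i + 1 < i + 2)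
      have hK : n (i + 2) ≤ K := (hmono.monotone (by omega : i + 2 ≤ I)).trans hI1
      rcases le_total ρ r with hρr | hρr
      · have := mul_pow_le_half_of_le h1 (hA j).le hρ hρr h3
        linarith [hinc j (n (i + 2)) (h2.trans hj) hK]
      · have := mul_pow_le_half_of_ge h2 (hA _).le hρ hr hρr h4
        -- Here a term is at most half of one that it dominates by unimodality, so both vanish and
        -- the claim is trivial.
        have h5 := hinc j (n (i + 1) + 1) h2 (hj.trans hK)
        have h6 := hinc (n i) (n (i + 1) + 1) (h1.trans h2) (hj.trans hK)
        linarith [hnn (n (i + 2)), hnn (n i)]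
    have hright : ∀ i, I + 1 ≤ i → A (n (i + 2)) * r ^ n (i + 2) ≤ A (n i) * r ^ n i / 2 := by
      intro i hi
      obtain ⟨ρ, j, hρ, h1, h2, h3, h4⟩ := hcross i
      have hj : n (i + 1) + 1 ≤ n (i + 2) := hmono (by omega : i + 1 < i + 2)
      have hK : K ≤ n i := hI2.le.trans (hmono.monotone hi)
      rcases le_total ρ r with hρr | hρr
      · have := mul_pow_le_half_of_le h1 (hA j).le hρ hρr h3
        have h5 := hdecr (n i) j hK h1
        have h6 := hdecr (n i) (n (i + 2)) hK (by omega)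
        linarith [hnn (n i)]
      · have := mul_pow_le_half_of_ge h2 (hA _).le hρ hr hρr h4
        have h5 := hdecr (n i) j hK h1
        have h6 := hdecr (n (i + 1) + 1) (n (i + 2)) (by omega) hj
        linarith
    refine ⟨K, fun N => ?_⟩
    have hs1 : ∑ i ∈ Finset.range (I + 1), A (n i) * r ^ n i ≤ 4 * (A K * r ^ K) :=
      sum_le_of_le_half_succ_succ (a := fun i => A (n i) * r ^ n i) (fun i => hmax _)
        (fun i => hnn _) hleft
    have hs2 : ∑ i ∈ Finset.range N, A (n (I + 1 + i)) * r ^ n (I + 1 + i) ≤ 4 * (A K * r ^ K) :=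
      sum_le_of_succ_succ_le_half (a := fun i => A (n (I + 1 + i)) * r ^ n (I + 1 + i))
        (fun i => hmax _) (fun i => hnn _) (fun i => hright (I + 1 + i) (by omega)) N
    have hs3 : ∑ i ∈ Finset.range N, A (n i) * r ^ n i
        ≤ ∑ i ∈ Finset.range (I + 1 + N), A (n i) * r ^ n i :=
      Finset.sum_le_sum_of_subset_of_nonneg (Finset.range_mono (by omega)) fun i _ _ => hnn _
    rw [Finset.sum_range_add] at hs3
    linarith

end Sparse

/-! ### Largest monomials below a weight, and Taylor coefficients. -/

noncomputable section Coefficients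

/-- A radius at which `r ^ k / w r` is maximal. -/
lemma Weight.exists_touch (w : Weight) (k : ℕ) :
    ∃ ρ : ℝ, 0 ≤ ρ ∧ 0 < ρ ^ k ∧ ∀ r, 0 ≤ r → r ^ k / w r ≤ ρ ^ k / w ρ := by
  have h1 : 0 < (1 : ℝ) ^ k / w 1 := div_pos (by simp) (w.pos' 1 zero_le_one)
  have hc : ContinuousOn (fun r : ℝ => r ^ k / w r) (Ici 0) :=
    (continuous_pow k).continuousOn.div w.continuousOn' fun r hr => (w.pos' r hr).ne'
  -- The comparison point is `1` because the quotient vanishes at `0` when `k > 0`.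
  obtain ⟨ρ, hρ, hmax⟩ := hc.exists_isMaxOn' isClosed_Ici (x₀ := 1) (mem_Ici.2 zero_le_one) (by
    rw [cocompact_eq_atBot_atTop, inf_sup_right, eventually_sup]
    refine ⟨?_, ((w.tendsto_pow_div k).eventually_le_const h1).filter_mono inf_le_left⟩
    have : atBot ⊓ 𝓟 (Ici (0 : ℝ)) = ⊥ := by
      rw [← disjoint_iff]
      exact disjoint_principal_right.2 (by
        filter_upwards [eventually_lt_atBot (0 : ℝ)] with x hx using not_le.2 hx)
    rw [this]
    exact eventually_bot)
  refine ⟨ρ, hρ, ?_, fun r hr => hmax hr⟩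
  have h2 : (1 : ℝ) ^ k / w 1 ≤ ρ ^ k / w ρ := hmax (mem_Ici.2 zero_le_one)
  exact (div_pos_iff_of_pos_right (w.pos' ρ hρ)).1 (h1.trans_le h2)

/-- A radius at which the largest monomial of degree `k` below `w` touches `w`. -/
def Weight.touch (w : Weight) (k : ℕ) : ℝ := (w.exists_touch k).choose

/-- The coefficient of the largest monomial of degree `k` below `w`. -/
def Weight.coeff (w : Weight) (k : ℕ) : ℝ := w (w.touch k) / w.touch k ^ k

namespace Weight

variable (w : Weight)

lemma touch_nonneg (k : ℕ) : 0 ≤ w.touch k := (w.exists_touch k).choose_spec.1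

lemma touch_pow_pos (k : ℕ) : 0 < w.touch k ^ k := (w.exists_touch k).choose_spec.2.1

lemma touch_succ_pos (k : ℕ) : 0 < w.touch (k + 1) := by
  refine (w.touch_nonneg _).lt_of_ne fun h => ?_
  have := w.touch_pow_pos (k + 1)
  rw [← h] at this
  simp at this

lemma coeff_pos (k : ℕ) : 0 < w.coeff k :=
  div_pos (w.pos' _ (w.touch_nonneg k)) (w.touch_pow_pos k)

lemma coeff_mul_touch (k : ℕ) : w.coeff k * w.touch k ^ k = w (w.touch k) :=
  div_mul_cancel₀ _ (w.touch_pow_pos k).ne'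

lemma coeff_mul_pow_le (k : ℕ) {r : ℝ} (hr : 0 ≤ r) : w.coeff k * r ^ k ≤ w r := by
  have h := (w.exists_touch k).choose_spec.2.2 r hr
  change r ^ k / w r ≤ w.touch k ^ k / w (w.touch k) at h
  rw [div_le_div_iff₀ (w.pos' r hr) (w.pos' _ (w.touch_nonneg k))] at h
  rw [coeff, div_mul_eq_mul_div, div_le_iff₀ (w.touch_pow_pos k)]
  linarith

/-- Where the monomial of degree `k + 1` touches `w`, both neighbouring monomials lie below it;
multiply the two inequalities. -/
lemma coeff_logConcave (k : ℕ) : w.coeff k * w.coeff (k + 2) ≤ w.coeff (k + 1) ^ 2 := by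
  set ρ := w.touch (k + 1) with hρ
  have hpos : 0 < ρ := w.touch_succ_pos k
  have h1 := w.coeff_mul_pow_le k hpos.le
  have h2 := w.coeff_mul_pow_le (k + 2) hpos.le
  rw [hρ, ← w.coeff_mul_touch (k + 1), ← hρ] at h1 h2
  have h3 := mul_le_mul h1 h2 (by have := w.coeff_pos (k + 2); positivity)
    (by have := w.coeff_pos (k + 1); positivity)
  refine le_of_mul_le_mul_right ?_ (show 0 < (ρ ^ (k + 1)) ^ 2 by positivity)
  calc _ = w.coeff k * ρ ^ k * (w.coeff (k + 2) * ρ ^ (k + 2)) := by ring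
    _ ≤ _ := h3
    _ = _ := by ring

lemma summable_coeff {r : ℝ} (hr : 0 ≤ r) : Summable fun k => w.coeff k * r ^ k := by
  refine Summable.of_nonneg_of_le
    (fun k => mul_nonneg (w.coeff_pos k).le (pow_nonneg hr k)) (fun k => ?_)
    (summable_geometric_two.mul_left (w (2 * r)))
  have h := w.coeff_mul_pow_le k (mul_nonneg zero_le_two hr)
  rw [one_div, inv_pow, ← div_eq_mul_inv, le_div_iff₀ (by positivity)]
  rw [mul_pow] at h
  linarith

lemma tendsto_coeff {r : ℝ} (hr : 0 ≤ r) : Tendsto (fun k => w.coeff k * r ^ k) atTop (𝓝 0) :=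
  (w.summable_coeff hr).tendsto_atTop_zero

/-- If all touching radii were at most `t`, then `w 0 ≤ w.coeff k * t ^ k`, which tends to zero. -/
lemma exists_lt_touch (t : ℝ) : ∃ k, t < w.touch k := by
  by_contra! h
  have ht : 0 ≤ t := (w.touch_nonneg 0).trans (h 0)
  obtain ⟨k, hk⟩ := ((w.tendsto_coeff ht).eventually_lt_const (w.pos' 0 le_rfl)).exists
  have h1 : w 0 ≤ w (w.touch k) :=
    w.monotoneOn' self_mem_Ici (w.touch_nonneg k) (w.touch_nonneg k)
  rw [← w.coeff_mul_touch] at h1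
  have := mul_le_mul_of_nonneg_left (pow_le_pow_left₀ (w.touch_nonneg k) (h k) k)
    (w.coeff_pos k).le
  linarith

lemma exists_touch_interval {t : ℝ} (ht : w.touch 0 < t) :
    ∃ k, w.touch k ≤ t ∧ t < w.touch (k + 1) := by
  classical
  have hex := w.exists_lt_touch t
  obtain ⟨k, hk⟩ : ∃ k, Nat.find hex = k + 1 := by
    refine Nat.exists_eq_succ_of_ne_zero fun h => ?_
    have := Nat.find_spec hex
    rw [h] at this
    exact lt_asymm ht this
  exact ⟨k, not_lt.1 (Nat.find_min hex (by omega)), hk ▸ Nat.find_spec hex⟩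

end Weight

/-- The Taylor coefficients of a function at the origin. -/
def taylorCoeff (f : ℂ → ℂ) (k : ℕ) : ℂ := (k.factorial : ℂ)⁻¹ * iteratedDeriv k f 0

lemma hasSum_taylorCoeff {f : ℂ → ℂ} (hf : Differentiable ℂ f) (z : ℂ) :
    HasSum (fun k => taylorCoeff f k * z ^ k) (f z) := by
  have h : ∀ k, taylorCoeff f k * z ^ k
      = (k.factorial : ℂ)⁻¹ • (z - 0) ^ k • iteratedDeriv k f 0 := fun k => by
    rw [taylorCoeff, sub_zero, smul_eq_mul, smul_eq_mul]
    ring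
  simp only [h]
  exact Complex.hasSum_taylorSeries_of_entire hf 0 z

lemma norm_taylorCoeff_mul_pow_le {f : ℂ → ℂ} (hf : Differentiable ℂ f) {R C : ℝ} (hR : 0 ≤ R)
    (h : ∀ z : ℂ, ‖z‖ = R → ‖f z‖ ≤ C) (k : ℕ) : ‖taylorCoeff f k‖ * R ^ k ≤ C := by
  rcases hR.eq_or_lt with rfl | hR
  · have h0 : ‖f 0‖ ≤ C := h 0 norm_zero
    rcases k with _ | k
    · simpa [taylorCoeff] using h0
    · simpa using (norm_nonneg _).trans h0
  · have := Complex.norm_iteratedDeriv_le_of_forall_mem_sphere_norm_le (c := 0) (f := f) k hR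
      hf.diffContOnCl (fun z hz => h z (by simpa using hz))
    rw [taylorCoeff, norm_mul, norm_inv, Complex.norm_natCast]
    have hk : (0 : ℝ) < k.factorial := by exact_mod_cast k.factorial_pos
    rw [le_div_iff₀ (by positivity)] at this
    rw [mul_assoc, inv_mul_le_iff₀ hk]
    exact this

lemma IsDominated.norm_taylorCoeff_le {w : Weight} {f : ℂ → ℂ} (hf : IsDominated w f) (k : ℕ) :
    ‖taylorCoeff f k‖ ≤ w.coeff k := by
  rw [Weight.coeff, le_div_iff₀ (w.touch_pow_pos k)]
  exact norm_taylorCoeff_mul_pow_le hf.1 (w.touch_nonneg k) (fun z hz => hz ▸ hf.2 z) k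

/-- Maximum principle for `f z / z ^ m` on the annulus: a three-circles bound with integer exponent.
-/
lemma norm_mul_pow_le_of_annulus {f : ℂ → ℂ} (hf : Differentiable ℂ f) {a b C : ℝ} (m : ℕ)
    (ha : 0 < a) (h1 : ∀ z : ℂ, ‖z‖ = a → ‖f z‖ ≤ C * a ^ m)
    (h2 : ∀ z : ℂ, ‖z‖ = b → ‖f z‖ ≤ C * b ^ m) {z : ℂ} (hza : a < ‖z‖) (hzb : ‖z‖ < b) :
    ‖f z‖ ≤ C * ‖z‖ ^ m := by
  have hb : 0 < b := ha.trans (hza.trans hzb)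
  set U : Set ℂ := Metric.ball 0 b ∩ (Metric.closedBall 0 a)ᶜ with hU
  have hcl : closure U ⊆ {z | a ≤ ‖z‖} := by
    refine closure_minimal (fun z hz => ?_) (isClosed_le continuous_const continuous_norm)
    have : a < ‖z‖ := by simpa using hz.2
    exact this.le
  have hd : DiffContOnCl ℂ (fun z => f z / z ^ m) U := by
    refine DifferentiableOn.diffContOnCl fun z hz => ?_
    have hz0 : z ≠ 0 := norm_pos_iff.1 (ha.trans_le (hcl hz))
    exact ((hf z).div (differentiableAt_pow m) (pow_ne_zero m hz0)).differentiableWithinAt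
  have hfr : frontier U ⊆ {z | ‖z‖ = a ∨ ‖z‖ = b} := by
    refine (frontier_inter_subset _ _).trans ?_
    rw [frontier_compl, frontier_ball _ hb.ne', frontier_closedBall _ ha.ne']
    rintro z (hz | hz)
    · right; simpa using hz.1
    · left; simpa using hz.2
  have key := Complex.norm_le_of_forall_mem_frontier_norm_le (U := U) (C := C)
    (Metric.isBounded_ball.subset inter_subset_left) hd (fun z hz => by
      have hpos : 0 < ‖z‖ := by rcases hfr hz with h | h <;> rw [h] <;> assumption
      rw [norm_div, norm_pow, div_le_iff₀ (by positivity)]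
      rcases hfr hz with h | h
      · have := h1 z h; rwa [← h] at this
      · have := h2 z h; rwa [← h] at this)
    (z := z) (subset_closure ⟨by simpa using hzb, by simpa using hza⟩)
  rw [norm_div, norm_pow, div_le_iff₀ (pow_pos (ha.trans hza) m)] at key
  exact key

/-- Up to an absolute constant, an entire function below a weight is bounded by the maximal
monomial below the weight. -/
lemma IsDominated.exists_maxModulus_le {w : Weight} {f : ℂ → ℂ} (hf : IsDominated w f) {t : ℝ}
    (ht : 0 ≤ t) : ∃ k, maxModulus f t ≤ 4 * (w.coeff k * t ^ k) := by
  have hsph : ∀ k (z : ℂ), ‖z‖ = w.touch k → ‖f z‖ ≤ w.coeff k * w.touch k ^ k := by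
    intro k z hz
    rw [w.coeff_mul_touch, ← hz]
    exact hf.2 z
  rcases le_or_gt t (w.touch 0) with h0 | h0
  · refine ⟨0, (maxModulus_mono hf.1 ht h0).trans ?_⟩
    rw [maxModulus_le_iff hf.1.continuous (w.touch_nonneg 0)]
    intro z hz
    have := hsph 0 z hz
    simp only [pow_zero] at this ⊢
    linarith [w.coeff_pos 0]
  obtain ⟨k, hk1, hk2⟩ := w.exists_touch_interval h0
  have ht0 : 0 < t := (w.touch_nonneg 0).trans_lt h0
  set A := w.coeff k with hA
  set B := w.coeff (k + 1) with hB
  set a := w.touch k with ha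
  set b := w.touch (k + 1) with hb
  have hA0 : 0 < A := w.coeff_pos k
  have hB0 : 0 < B := w.coeff_pos (k + 1)
  have ha0 : 0 ≤ a := w.touch_nonneg k
  have hb0 : 0 < b := ht0.trans hk2
  have hBA : B * a ≤ A := by
    have h1 := w.coeff_mul_pow_le (k + 1) ha0
    rw [ha, ← w.coeff_mul_touch k, ← ha, ← hA, ← hB, pow_succ, mul_comm (a ^ k), ← mul_assoc] at h1
    exact le_of_mul_le_mul_right h1 (w.touch_pow_pos k)
  have hAB : A ≤ B * b := by
    have h1 := w.coeff_mul_pow_le k hb0.le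
    rw [hb, ← w.coeff_mul_touch (k + 1), ← hb, ← hA, ← hB, pow_succ, mul_comm (b ^ k),
      ← mul_assoc] at h1
    exact le_of_mul_le_mul_right h1 (pow_pos hb0 k)
  -- Close to `a`, dividing `f` by `z ^ (k + 1)` loses only the factor `t / a ≤ 2`; close to `b`,
  -- dividing by `z ^ k` loses only `b / t ≤ 2`.
  rcases le_or_gt t (2 * a) with h2a | h2a
  · have ha0' : 0 < a := by linarith
    refine ⟨k, (maxModulus_le_iff hf.1.continuous ht).2 fun z hz => ?_⟩
    rcases hk1.eq_or_lt with h | h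
    · have := hsph k z (hz.trans h.symm)
      rw [← ha, h, ← hA] at this
      have : 0 < A * t ^ k := by positivity
      linarith
    · have := norm_mul_pow_le_of_annulus (a := a) (b := b) (C := A / a) hf.1 (k + 1) ha0'
        (fun z hz => (hsph k z hz).trans_eq (by rw [← hA, ← ha]; field_simp; ring))
        (fun z hz => (hsph (k + 1) z hz).trans
          (mul_le_mul_of_nonneg_right ((le_div_iff₀ ha0').2 hBA) (by positivity)))
        (hz ▸ h) (hz ▸ hk2)
      rw [hz] at this
      refine this.trans ?_
      rw [div_mul_eq_mul_div, div_le_iff₀ ha0', pow_succ]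
      have : 0 < A * t ^ k := by positivity
      nlinarith
  rcases le_or_gt b (2 * t) with h2b | h2b
  · have ht2 : 0 < t ^ k := by positivity
    refine ⟨k + 1, (maxModulus_le_iff hf.1.continuous ht).2 fun z hz => ?_⟩
    have : ‖f z‖ ≤ B * b * t ^ k := by
      rcases ha0.eq_or_lt with h | ha0'
      · have hk : k = 0 := by
          by_contra hk
          have := w.touch_pow_pos k
          rw [← ha, ← h, zero_pow hk] at this
          exact lt_irrefl _ this
        subst hk
        have := norm_le_of_sphere_le hf.1 (hsph 1) (z := z) (by rw [hz]; exact hk2.le)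
        rw [pow_zero, mul_one]
        simpa using this
      · have := norm_mul_pow_le_of_annulus (a := a) (b := b) (C := B * b) hf.1 k ha0'
          (fun z hz => (hsph k z hz).trans (mul_le_mul_of_nonneg_right hAB (by positivity)))
          (fun z hz => (hsph (k + 1) z hz).trans_eq (by rw [← hB, ← hb]; ring))
          (z := z) (by rw [hz]; linarith) (hz ▸ hk2)
        rwa [hz] at this
    refine this.trans ?_
    rw [pow_succ]
    have : 0 < B * t ^ k := by positivity
    nlinarith
  -- Far from both radii, Cauchy estimates at `b` for degrees above `k` and at `a` for the others
  -- give two geometric series, each at most `2 * M`.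
  · set M := max (A * t ^ k) (B * t ^ (k + 1)) with hM
    have hM0 : 0 < M := lt_max_of_lt_left (by positivity)
    have hterm1 : ∀ j, ‖taylorCoeff f (j + (k + 1))‖ * t ^ (j + (k + 1)) ≤ M * (1 / 2) ^ j := by
      intro j
      have h1 := norm_taylorCoeff_mul_pow_le hf.1 hb0.le (hsph (k + 1)) (j + (k + 1))
      rw [← hb, ← hB, pow_add, ← mul_assoc] at h1
      have h2 : ‖taylorCoeff f (j + (k + 1))‖ * b ^ j ≤ B :=
        le_of_mul_le_mul_right h1 (by positivity)
      have h3 : (2 * t) ^ j ≤ b ^ j := pow_le_pow_left₀ (by positivity) h2b.le j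
      have h4 : ‖taylorCoeff f (j + (k + 1))‖ * (2 * t) ^ j ≤ B :=
        (mul_le_mul_of_nonneg_left h3 (norm_nonneg _)).trans h2
      have h5 := (mul_le_mul_of_nonneg_right h4 (show 0 ≤ t ^ (k + 1) by positivity)).trans
        (le_max_right (A * t ^ k) _)
      rw [one_div, inv_pow, ← div_eq_mul_inv, le_div_iff₀ (by positivity)]
      refine le_trans (le_of_eq ?_) h5
      rw [mul_pow]; ring
    have hterm2 : ∀ j ≤ k, ‖taylorCoeff f j‖ * t ^ j ≤ M * (1 / 2) ^ (k - j) := by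
      intro j hj
      obtain ⟨m, rfl⟩ := Nat.exists_eq_add_of_le hj
      have h1 := norm_taylorCoeff_mul_pow_le hf.1 ha0 (hsph _) j
      rw [← ha, ← hA] at h1
      have hapow : 0 < a ^ (j + m) := w.touch_pow_pos _
      -- The radius `a` may be zero, but only when `k = 0`, and then `j = 0`.
      have haj : 0 < a ^ j := by
        refine (pow_nonneg ha0 j).lt_of_ne fun h => ?_
        rw [pow_add, ← h, zero_mul] at hapow
        exact lt_irrefl _ hapow
      rw [pow_add, mul_comm (a ^ j), ← mul_assoc] at h1
      have h2 : ‖taylorCoeff f j‖ ≤ A * a ^ m := le_of_mul_le_mul_right h1 haj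
      have h3 : a ^ m ≤ (t / 2) ^ m := pow_le_pow_left₀ ha0 (by linarith) m
      have h4 := mul_le_mul_of_nonneg_right (h2.trans (mul_le_mul_of_nonneg_left h3 hA0.le))
        (pow_nonneg ht j)
      rw [Nat.add_sub_cancel_left]
      refine h4.trans ?_
      have h5 := mul_le_mul_of_nonneg_right (le_max_left (A * t ^ (j + m)) (B * t ^ (j + m + 1)))
        (show (0 : ℝ) ≤ (1 / 2) ^ m by positivity)
      refine le_trans (le_of_eq ?_) h5
      rw [div_pow, pow_add, div_pow, one_pow]; ring
    have hfin : ∑ j ∈ Finset.range (k + 1), ‖taylorCoeff f j‖ * t ^ j ≤ M * 2 := by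
      calc _ ≤ ∑ j ∈ Finset.range (k + 1), M * (1 / 2 : ℝ) ^ (k + 1 - 1 - j) :=
            Finset.sum_le_sum fun j hj =>
              hterm2 j (Nat.lt_succ_iff.1 (Finset.mem_range.1 hj))
        _ = M * ∑ j ∈ Finset.range (k + 1), (1 / 2 : ℝ) ^ j := by
            rw [Finset.sum_range_reflect (fun j => M * (1 / 2 : ℝ) ^ j), Finset.mul_sum]
        _ ≤ M * 2 := mul_le_mul_of_nonneg_left (sum_geometric_two_le _) hM0.le
    have hsum : Summable fun j => ‖taylorCoeff f j‖ * t ^ j :=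
      (summable_nat_add_iff (k + 1)).1 (Summable.of_nonneg_of_le (fun j => by positivity) hterm1
        (summable_geometric_two.mul_left M))
    have htail : ∑' j, ‖taylorCoeff f (j + (k + 1))‖ * t ^ (j + (k + 1)) ≤ M * 2 := by
      rw [← tsum_geometric_two, ← tsum_mul_left]
      exact ((summable_nat_add_iff (k + 1)).2 hsum).tsum_le_tsum hterm1
        (summable_geometric_two.mul_left M)
    have htot : ∑' j, ‖taylorCoeff f j‖ * t ^ j ≤ 4 * M := by
      rw [← hsum.sum_add_tsum_nat_add (k + 1)]
      linarith
    have hmax : maxModulus f t ≤ 4 * M := by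
      refine (maxModulus_le_iff hf.1.continuous ht).2 fun z hz => ?_
      rw [← (hasSum_taylorCoeff hf.1 z).tsum_eq]
      refine le_trans (norm_tsum_le_tsum_norm ?_) ?_ <;> simpa [hz] using by assumption
    rcases le_total (A * t ^ k) (B * t ^ (k + 1)) with h | h
    · exact ⟨k + 1, by rwa [hM, max_eq_right h] at hmax⟩
    · exact ⟨k, by rwa [hM, max_eq_left h] at hmax⟩

/-- The sum of the power series with the given coefficients. -/
def powerSum (b : ℕ → ℂ) (z : ℂ) : ℂ := ∑' k, b k * z ^ k

variable {w : Weight} {b : ℕ → ℂ}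

lemma norm_mul_pow_le_coeff (hb : ∀ k, ‖b k‖ ≤ w.coeff k) {z : ℂ} {r : ℝ} (hz : ‖z‖ ≤ r) (k : ℕ) :
    ‖b k * z ^ k‖ ≤ w.coeff k * r ^ k := by
  rw [norm_mul, norm_pow]
  exact mul_le_mul (hb k) (pow_le_pow_left₀ (norm_nonneg z) hz k) (by positivity)
    (w.coeff_pos k).le

lemma hasSum_powerSum (hb : ∀ k, ‖b k‖ ≤ w.coeff k) (z : ℂ) :
    HasSum (fun k => b k * z ^ k) (powerSum b z) :=
  (Summable.of_norm_bounded (w.summable_coeff (norm_nonneg z))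
    (norm_mul_pow_le_coeff hb le_rfl)).hasSum

lemma differentiable_powerSum (hb : ∀ k, ‖b k‖ ≤ w.coeff k) : Differentiable ℂ (powerSum b) := by
  intro z
  have h : DifferentiableOn ℂ (powerSum b) (Metric.ball 0 (‖z‖ + 1)) :=
    Complex.differentiableOn_tsum_of_summable_norm
      (w.summable_coeff (r := ‖z‖ + 1) (by positivity)) (fun k => by fun_prop) Metric.isOpen_ball
      fun k y hy => norm_mul_pow_le_coeff hb (by simpa using (mem_ball_zero_iff.1 hy).le) k
  exact h.differentiableAt (Metric.isOpen_ball.mem_nhds (by simp))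

end Coefficients

/-! ### Condition (i) implies compactness. -/

section Compactness

variable {w u : Weight}

lemma IsDominated.norm_integrationOp_le {f : ℂ → ℂ} (hf : IsDominated w f) (z : ℂ) :
    ‖integrationOp f z‖ ≤ ∫ t in (0 : ℝ)..‖z‖, associatedWeight w t :=
  _root_.norm_integrationOp_le z
    (associatedWeight_intervalIntegrable w le_rfl (norm_nonneg z))
    fun y _ => norm_le_associatedWeight hf y

lemma integral_associatedWeight_nonneg {r : ℝ} (hr : 0 ≤ r) :
    0 ≤ ∫ t in (0 : ℝ)..r, associatedWeight w t :=
  intervalIntegral.integral_nonneg hr fun _ ht => associatedWeight_nonneg w ht.1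

lemma integral_associatedWeight_mono {r s : ℝ} (hr : 0 ≤ r) (hrs : r ≤ s) :
    ∫ t in (0 : ℝ)..r, associatedWeight w t ≤ ∫ t in (0 : ℝ)..s, associatedWeight w t := by
  have hs := hr.trans hrs
  rw [← intervalIntegral.integral_add_adjacent_intervals
    (associatedWeight_intervalIntegrable w le_rfl hr)
    (associatedWeight_intervalIntegrable w hr hs)]
  exact le_add_of_nonneg_right
    (intervalIntegral.integral_nonneg hrs fun _ ht => associatedWeight_nonneg w (hr.trans ht.1))

lemma exists_integral_associatedWeight_le_of_tendsto
    (h : Tendsto (fun r : ℝ => 1 / u r * ∫ t in (0 : ℝ)..r, associatedWeight w t) atTop (𝓝 0))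
    {ε : ℝ} (hε : 0 < ε) :
    ∃ R, 0 ≤ R ∧ ∀ r, R ≤ r → ∫ t in (0 : ℝ)..r, associatedWeight w t ≤ ε * u r := by
  obtain ⟨R, hR⟩ := eventually_atTop.1
    ((h.eventually_le_const hε).and (eventually_ge_atTop (0 : ℝ)))
  refine ⟨max R 0, le_max_right _ _, fun r hr => ?_⟩
  obtain ⟨h1, h0⟩ := hR r ((le_max_left _ _).trans hr)
  rwa [one_div, inv_mul_le_iff₀ (u.pos' r h0), mul_comm] at h1

lemma exists_integral_associatedWeight_le
    (h : Tendsto (fun r : ℝ => 1 / u r * ∫ t in (0 : ℝ)..r, associatedWeight w t) atTop (𝓝 0)) :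
    ∃ C, 0 ≤ C ∧ ∀ r, 0 ≤ r → ∫ t in (0 : ℝ)..r, associatedWeight w t ≤ C * u r := by
  obtain ⟨R, hR0, hR⟩ := exists_integral_associatedWeight_le_of_tendsto h one_pos
  have hu0 := u.pos' 0 le_rfl
  have hI := integral_associatedWeight_nonneg (w := w) hR0
  refine ⟨1 + (∫ t in (0 : ℝ)..R, associatedWeight w t) / u 0, by positivity, fun r hr => ?_⟩
  have hur := u.pos' r hr
  have hu : u 0 ≤ u r := u.monotoneOn' self_mem_Ici hr hr
  rw [add_mul]
  rcases le_total R r with h1 | h1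
  · exact (hR r h1).trans (le_add_of_nonneg_right (by positivity))
  · refine (integral_associatedWeight_mono hr h1).trans ?_
    refine le_trans ?_ (le_add_of_nonneg_left (by positivity))
    rw [div_mul_eq_mul_div, le_div_iff₀ hu0]
    exact mul_le_mul_of_nonneg_left hu hI

lemma GrowthSpace.norm_integrationOp_le (f : GrowthSpace w) (z : ℂ) :
    ‖integrationOp f z‖ ≤ ‖f‖ * ∫ t in (0 : ℝ)..‖z‖, associatedWeight w t := by
  rcases (norm_nonneg f).eq_or_lt with h | h
  · have h0 : f = 0 := norm_eq_zero.1 h.symm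
    have h1 : ∀ y, f y = 0 := fun y => by rw [h0]; rfl
    simp [integrationOp, h1, ← h]
  · have hd := (IsDominated.smul f.differentiable h f.norm_apply_le).norm_integrationOp_le z
    have h1 : integrationOp (((‖f‖ : ℝ) : ℂ)⁻¹ • ⇑f) z = ((‖f‖ : ℝ) : ℂ)⁻¹ * integrationOp f z :=
      integrationOp_const_mul _ _ _
    rw [h1, norm_mul, norm_inv, Complex.norm_real, norm_norm, inv_mul_le_iff₀ h] at hd
    exact hd

/-- A quantitative form of Montel's theorem for entire functions below a weight. -/
lemma exists_subseq_tendstoLocallyUniformly {f : ℕ → ℂ → ℂ} (hf : ∀ n, IsDominated w (f n)) :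
    ∃ g, IsDominated w g ∧ ∃ φ : ℕ → ℕ, StrictMono φ ∧ ∀ R : ℝ, 0 ≤ R →
      ∃ e : ℕ → ℝ, Tendsto e atTop (𝓝 0) ∧ ∀ n z, ‖z‖ ≤ R → ‖f (φ n) z - g z‖ ≤ e n := by
  -- Taylor coefficients lie in a compact product of discs; coefficientwise convergence becomes
  -- uniform on discs by dominated convergence.
  have hK : IsCompact (pi univ fun k => Metric.closedBall (0 : ℂ) (w.coeff k)) :=
    isCompact_univ_pi fun k => isCompact_closedBall _ _
  obtain ⟨b, hb, φ, hφ, hlim⟩ := hK.tendsto_subseq (x := fun n => taylorCoeff (f n))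
    fun n k _ => by simpa using (hf n).norm_taylorCoeff_le k
  have hb' : ∀ k, ‖b k‖ ≤ w.coeff k := fun k => by simpa using hb k (mem_univ k)
  have hlim' : ∀ k, Tendsto (fun n => taylorCoeff (f (φ n)) k) atTop (𝓝 (b k)) :=
    fun k => (tendsto_pi_nhds.1 hlim) k
  have hunif : ∀ R : ℝ, 0 ≤ R → ∃ e : ℕ → ℝ, Tendsto e atTop (𝓝 0) ∧
      ∀ n z, ‖z‖ ≤ R → ‖f (φ n) z - powerSum b z‖ ≤ e n := by
    intro R hR
    have hbd : ∀ n k, ‖taylorCoeff (f (φ n)) k - b k‖ * R ^ k ≤ 2 * (w.coeff k * R ^ k) := by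
      intro n k
      rw [← mul_assoc]
      refine mul_le_mul_of_nonneg_right ?_ (by positivity)
      linarith [norm_sub_le (taylorCoeff (f (φ n)) k) (b k), hb' k,
        (hf (φ n)).norm_taylorCoeff_le k]
    have hs := (w.summable_coeff hR).mul_left 2
    refine ⟨fun n => ∑' k, ‖taylorCoeff (f (φ n)) k - b k‖ * R ^ k, ?_, fun n z hz => ?_⟩
    · rw [← tsum_zero (α := ℝ) (β := ℕ)]
      refine tendsto_tsum_of_dominated_convergence hs (fun k => ?_) (Eventually.of_forall
        fun n k => ?_)
      · have := (((hlim' k).sub_const (b k)).norm).mul_const (R ^ k)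
        simpa using this
      · rw [Real.norm_of_nonneg (by positivity)]
        exact hbd n k
    · have h1 := (hasSum_taylorCoeff (hf (φ n)).1 z).sub (hasSum_powerSum hb' z)
      rw [← h1.tsum_eq]
      refine tsum_of_norm_bounded (Summable.of_nonneg_of_le (fun k => by positivity)
        (hbd n) hs).hasSum fun k => ?_
      rw [← sub_mul, norm_mul, norm_pow]
      exact mul_le_mul_of_nonneg_left (pow_le_pow_left₀ (norm_nonneg z) hz k) (norm_nonneg _)
  refine ⟨powerSum b, ⟨differentiable_powerSum hb', fun z => ?_⟩, φ, hφ, hunif⟩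
  obtain ⟨e, he, h⟩ := hunif ‖z‖ (norm_nonneg z)
  have hle : ∀ n, ‖powerSum b z‖ ≤ w ‖z‖ + e n := fun n => by
    have h1 := norm_sub_norm_le (powerSum b z) (f (φ n) z)
    rw [norm_sub_rev] at h1
    linarith [h n z le_rfl, (hf (φ n)).2 z]
  have := ge_of_tendsto' (he.const_add (w ‖z‖)) hle
  rwa [add_zero] at this

lemma exists_isCompactOperator_of_tendsto
    (h : Tendsto (fun r : ℝ => 1 / u r * ∫ t in (0 : ℝ)..r, associatedWeight w t) atTop (𝓝 0)) :
    ∃ T : GrowthSpace w →L[ℂ] GrowthSpace u,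
      (∀ (f : GrowthSpace w) (z : ℂ), T f z = integrationOp f z) ∧ IsCompactOperator T := by
  obtain ⟨C, hC0, hC⟩ := exists_integral_associatedWeight_le h
  have hbound : ∀ (f : GrowthSpace w) (z : ℂ), ‖integrationOp f z‖ ≤ C * ‖f‖ * u ‖z‖ := by
    intro f z
    refine (f.norm_integrationOp_le z).trans ?_
    have := mul_le_mul_of_nonneg_left (hC ‖z‖ (norm_nonneg z)) (norm_nonneg f)
    linarith
  have hdiff : ∀ f : GrowthSpace w, Differentiable ℂ (integrationOp f) := fun f z =>
    (hasDerivAt_integrationOp f.differentiable z).differentiableAt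
  let T₀ : GrowthSpace w →ₗ[ℂ] GrowthSpace u :=
    { toFun := fun f => GrowthSpace.mk (integrationOp f)
        (GrowthSpace.mem_growthSubmodule (hdiff f) (hbound f))
      map_add' := fun f g => GrowthSpace.ext fun z =>
        integrationOp_add f.differentiable.continuous g.differentiable.continuous z
      map_smul' := fun c f => GrowthSpace.ext fun z => integrationOp_const_mul c f z }
  let T : GrowthSpace w →L[ℂ] GrowthSpace u := T₀.mkContinuous C fun f =>
    GrowthSpace.norm_le_of_forall (hbound f)
  have hT : ∀ (f : GrowthSpace w) (z : ℂ), T f z = integrationOp f z := fun f z => rfl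
  -- The image of the closed unit ball is itself compact, since the Montel limit stays in that ball.
  refine ⟨T, hT, T '' Metric.closedBall 0 1, IsSeqCompact.isCompact ?_,
    mem_of_superset (Metric.closedBall_mem_nhds 0 one_pos) (subset_preimage_image _ _)⟩
  intro x hx
  choose f hf hfx using hx
  have hdom : ∀ n, IsDominated w (f n) := fun n =>
    GrowthSpace.isDominated (by simpa using hf n)
  obtain ⟨g, hg, φ, hφ, hunif⟩ := exists_subseq_tendstoLocallyUniformly hdom
  have hgw : ∀ z, ‖g z‖ ≤ 1 * w ‖z‖ := fun z => (hg.2 z).trans_eq (one_mul _).symm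
  let G : GrowthSpace w := GrowthSpace.mk g (GrowthSpace.mem_growthSubmodule hg.1 hgw)
  have hG : G ∈ Metric.closedBall (0 : GrowthSpace w) 1 := by
    rw [mem_closedBall_zero_iff]
    exact GrowthSpace.norm_le_of_forall hgw
  refine ⟨T G, mem_image_of_mem T hG, φ, hφ, ?_⟩
  rw [tendsto_iff_norm_sub_tendsto_zero]
  refine tendsto_order.2 ⟨fun a ha => Eventually.of_forall fun n => ha.trans_le (norm_nonneg _),
    fun ε hε => ?_⟩
  -- Differences of ball elements have norm at most `2`, so `ε / 4` yields `ε / 2` outside radius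
  -- `R`.
  obtain ⟨R, hR0, hR⟩ := exists_integral_associatedWeight_le_of_tendsto h
    (ε := ε / 4) (by positivity)
  obtain ⟨e, he, hfe⟩ := hunif R hR0
  have hu0 := u.pos' 0 le_rfl
  have he' : ∀ᶠ n in atTop, e n * R ≤ ε / 2 * u 0 := by
    refine (he.mul_const R).eventually_le_const ?_
    rw [zero_mul]
    positivity
  filter_upwards [he'] with n hn
  refine lt_of_le_of_lt (GrowthSpace.norm_le_of_forall (C := ε / 2) fun z => ?_)
    (half_lt_self hε)
  have hsub : (x (φ n) - T G) z = integrationOp (f (φ n) - G : GrowthSpace w) z := by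
    rw [← hfx, ← map_sub, hT]
  rw [Function.comp_apply, hsub]
  rcases le_total ‖z‖ R with hz | hz
  · have h1 : ‖integrationOp (f (φ n) - G : GrowthSpace w) z‖ ≤ ∫ _ in (0 : ℝ)..‖z‖, e n :=
      norm_integrationOp_le (g := fun _ => e n) z intervalIntegrable_const
        fun y hy => hfe n y (hy.trans hz)
    have h2 : u 0 ≤ u ‖z‖ := u.monotoneOn' self_mem_Ici (norm_nonneg z) (norm_nonneg z)
    have he0 : 0 ≤ e n := (norm_nonneg _).trans (hfe n 0 (by simpa using hR0))
    rw [intervalIntegral.integral_const, sub_zero, smul_eq_mul] at h1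
    have h3 : ε / 2 * u 0 ≤ ε / 2 * u ‖z‖ := mul_le_mul_of_nonneg_left h2 (by positivity)
    linarith [mul_le_mul_of_nonneg_right hz he0]
  · have h1 := (f (φ n) - G).norm_integrationOp_le z
    have h2 : ‖f (φ n) - G‖ ≤ 2 := by
      have h3 := mem_closedBall_zero_iff.1 (hf (φ n))
      have h4 := mem_closedBall_zero_iff.1 hG
      linarith [norm_sub_le (f (φ n)) G]
    have h5 := mul_le_mul_of_nonneg_right h2
      (integral_associatedWeight_nonneg (w := w) (norm_nonneg z))
    linarith [hR ‖z‖ hz]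

end Compactness

/-! ### Compactness implies condition (i). -/

section Necessity

variable {w u : Weight}

/-- A power series with non-negative coefficients which is comparable with the associated
weight. -/
lemma exists_powerSeries_comparable (w : Weight) :
    ∃ d : ℕ → ℝ, (∀ k, 0 ≤ d k) ∧ (∀ k, d k ≤ w.coeff k) ∧
      (∀ r, 0 ≤ r → associatedWeight w r ≤ 8 * ∑' k, d k * r ^ k) ∧
      ∀ r, 0 ≤ r → ∑' k, d k * r ^ k ≤ 8 * w r := by
  obtain ⟨n, hn, hlow, hup⟩ := exists_lacunary w.coeff_pos w.coeff_logConcave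
    fun r hr => w.tendsto_coeff hr
  have hdn : ∀ i, (range n).indicator w.coeff (n i) = w.coeff (n i) := fun i =>
    indicator_of_mem (mem_range_self i) _
  have hd0 : ∀ k, 0 ≤ (range n).indicator w.coeff k :=
    fun k => indicator_nonneg (fun j _ => (w.coeff_pos j).le) k
  have hdle : ∀ k, (range n).indicator w.coeff k ≤ w.coeff k :=
    fun k => indicator_le_self' (fun j _ => (w.coeff_pos j).le) k
  refine ⟨(range n).indicator w.coeff, hd0, hdle, fun r hr => associatedWeight_le fun f hf => ?_,
    fun r hr => ?_⟩
  -- The constant `8` is `4` from the maximal-term bound times `2` from the lacunary selection.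
  · obtain ⟨j, hj⟩ := hf.exists_maxModulus_le hr
    obtain ⟨i, hi⟩ := hlow r hr j
    have hs : Summable fun k => (range n).indicator w.coeff k * r ^ k :=
      Summable.of_nonneg_of_le (fun k => mul_nonneg (hd0 k) (pow_nonneg hr k))
        (fun k => mul_le_mul_of_nonneg_right (hdle k) (pow_nonneg hr k)) (w.summable_coeff hr)
    have := hs.le_tsum (n i) fun k _ => mul_nonneg (hd0 k) (pow_nonneg hr k)
    rw [hdn] at this
    linarith
  · obtain ⟨K, hK⟩ := hup r hr
    have h1 : ∑' i, w.coeff (n i) * r ^ n i = ∑' k, (range n).indicator w.coeff k * r ^ k := by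
      rw [← hn.injective.tsum_eq (f := fun k => (range n).indicator w.coeff k * r ^ k)]
      · simp only [hdn]
      · intro k hk
        by_contra hk'
        exact hk (by simp [indicator_of_notMem hk'])
    rw [← h1]
    refine Real.tsum_le_of_sum_range_le
      (fun i => mul_nonneg (w.coeff_pos _).le (pow_nonneg hr _)) fun N => (hK N).trans ?_
    linarith [w.coeff_mul_pow_le K hr]

/-- The coefficients of the tail of a power series. -/
def tailCoeff (d : ℕ → ℝ) (N k : ℕ) : ℂ := if k < N then 0 else (d k : ℂ)

lemma norm_tailCoeff_le {d : ℕ → ℝ} (hd0 : ∀ k, 0 ≤ d k) (N k : ℕ) : ‖tailCoeff d N k‖ ≤ d k := by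
  rw [tailCoeff]
  split_ifs
  · simpa using hd0 k
  · rw [Complex.norm_real, Real.norm_of_nonneg (hd0 k)]

lemma tendsto_of_isCompactOperator {T : GrowthSpace w →L[ℂ] GrowthSpace u}
    (hT : ∀ (f : GrowthSpace w) (z : ℂ), T f z = integrationOp f z) (hc : IsCompactOperator T) :
    Tendsto (fun r : ℝ => 1 / u r * ∫ t in (0 : ℝ)..r, associatedWeight w t) atTop (𝓝 0) := by
  obtain ⟨d, hd0, hdle, hlow, hup⟩ := exists_powerSeries_comparable w
  have htail : ∀ N k, ‖tailCoeff d N k‖ ≤ w.coeff k := fun N k =>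
    (norm_tailCoeff_le hd0 N k).trans (hdle k)
  have hsum : ∀ r : ℝ, 0 ≤ r → Summable fun k => d k * r ^ k := fun r hr =>
    Summable.of_nonneg_of_le (fun k => mul_nonneg (hd0 k) (pow_nonneg hr k))
      (fun k => mul_le_mul_of_nonneg_right (hdle k) (pow_nonneg hr k)) (w.summable_coeff hr)
  have hGdiff : ∀ N, Differentiable ℂ (powerSum (tailCoeff d N)) := fun N =>
    differentiable_powerSum (htail N)
  have hGle : ∀ N z, ‖powerSum (tailCoeff d N) z‖ ≤ 8 * w ‖z‖ := by
    intro N z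
    refine (tsum_of_norm_bounded (hsum _ (norm_nonneg z)).hasSum fun k => ?_).trans
      (hup _ (norm_nonneg z))
    rw [norm_mul, norm_pow]
    exact mul_le_mul_of_nonneg_right (norm_tailCoeff_le hd0 N k) (by positivity)
  let G : ℕ → GrowthSpace w := fun N => GrowthSpace.mk (powerSum (tailCoeff d N))
    (GrowthSpace.mem_growthSubmodule (hGdiff N) (hGle N))
  have hGball : ∀ N, G N ∈ Metric.closedBall (0 : GrowthSpace w) 8 := fun N => by
    rw [mem_closedBall_zero_iff]
    exact GrowthSpace.norm_le_of_forall (hGle N)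
  have hpt : ∀ z, Tendsto (fun N => T (G N) z) atTop (𝓝 0) := by
    intro z
    have h1 : Tendsto (fun N => ∑' k, ‖tailCoeff d N k‖ * ‖z‖ ^ k) atTop (𝓝 0) := by
      rw [← tsum_zero (α := ℝ) (β := ℕ)]
      refine tendsto_tsum_of_dominated_convergence (hsum ‖z‖ (norm_nonneg z)) (fun k => ?_)
        (Eventually.of_forall fun N k => ?_)
      · refine tendsto_const_nhds.congr' ?_
        filter_upwards [eventually_gt_atTop k] with N hN
        simp [tailCoeff, hN]
      · rw [Real.norm_of_nonneg (by positivity)]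
        exact mul_le_mul_of_nonneg_right (norm_tailCoeff_le hd0 N k) (by positivity)
    refine squeeze_zero_norm (fun N => ?_) (by simpa using h1.const_mul ‖z‖)
    rw [hT]
    have h2 : ‖integrationOp (G N) z‖
        ≤ ∫ _ in (0 : ℝ)..‖z‖, ∑' k, ‖tailCoeff d N k‖ * ‖z‖ ^ k := by
      refine norm_integrationOp_le (g := fun _ => ∑' k, ‖tailCoeff d N k‖ * ‖z‖ ^ k) z
        intervalIntegrable_const fun y hy => ?_
      refine tsum_of_norm_bounded (Summable.of_nonneg_of_le (fun k => by positivity)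
        (fun k => ?_) (hsum ‖z‖ (norm_nonneg z))).hasSum fun k => ?_
      · exact mul_le_mul_of_nonneg_right (norm_tailCoeff_le hd0 N k) (by positivity)
      · rw [norm_mul, norm_pow]
        exact mul_le_mul_of_nonneg_left (pow_le_pow_left₀ (norm_nonneg y) hy k) (norm_nonneg _)
    rwa [intervalIntegral.integral_const, sub_zero, smul_eq_mul] at h2
  have hsmall : ∀ ε > 0, ∃ N, ‖T (G N)‖ < ε := by
    intro ε hε
    have hc' : IsCompactOperator (T : GrowthSpace w →ₗ[ℂ] GrowthSpace u) := hc
    have hcomp := hc'.isCompact_closure_image_closedBall 8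
    obtain ⟨g, -, φ, hφ, hlim⟩ := hcomp.tendsto_subseq (x := fun N => T (G N))
      fun N => subset_closure (mem_image_of_mem T (hGball N))
    -- Norm convergence implies pointwise convergence, so the subsequential limit must be the
    -- pointwise limit zero.
    have hg : g = 0 := by
      rw [tendsto_iff_norm_sub_tendsto_zero] at hlim
      refine GrowthSpace.ext fun z => ?_
      have h1 : Tendsto (fun j => T (G (φ j)) z - g z) atTop (𝓝 0) := by
        refine squeeze_zero_norm (fun j => (T (G (φ j)) - g).norm_apply_le z) ?_
        simpa using hlim.mul_const (u ‖z‖)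
      have h2 := ((hpt z).comp hφ.tendsto_atTop).sub_const (g z)
      have h3 := tendsto_nhds_unique h1 h2
      rw [zero_sub, eq_comm, neg_eq_zero] at h3
      exact h3
    rw [hg] at hlim
    have hlim0 := hlim.norm
    rw [norm_zero] at hlim0
    obtain ⟨j, hj⟩ := (hlim0.eventually_lt_const hε).exists
    exact ⟨φ j, hj⟩
  -- The polynomial part is bounded by its value at `r`; the integral of the tail is `T (G N)` at
  -- the real point `r`.
  have hsplit : ∀ N r, 0 ≤ r → ∫ t in (0 : ℝ)..r, associatedWeight w t ≤
      8 * ∑ k ∈ Finset.range N, d k * r ^ (k + 1) + 8 * (‖T (G N)‖ * u r) := by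
    intro N r hr
    have hcont : Continuous fun t : ℝ => powerSum (tailCoeff d N) t :=
      (hGdiff N).continuous.comp Complex.continuous_ofReal
    have hpow : ∀ t ∈ Icc 0 r, associatedWeight w t ≤ 8 * ∑ k ∈ Finset.range N, d k * r ^ k
        + 8 * (powerSum (tailCoeff d N) t).re := by
      intro t ht
      have h1 : HasSum (fun k => if k < N then 0 else d k * t ^ k)
          (powerSum (tailCoeff d N) t).re := by
        have := Complex.hasSum_re (hasSum_powerSum (htail N) (t : ℂ))
        convert! this using 2 with k
        rw [tailCoeff]
        split_ifs
        · simp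
        · rw [← Complex.ofReal_pow, ← Complex.ofReal_mul, Complex.ofReal_re]
      have h2 : HasSum (fun k => if k < N then d k * t ^ k else 0)
          (∑ k ∈ Finset.range N, d k * t ^ k) := by
        rw [Finset.sum_congr rfl fun k hk => (if_pos (Finset.mem_range.1 hk)).symm]
        exact hasSum_sum_of_ne_finset_zero fun k hk => if_neg (by simpa using hk)
      have h3 : ∑' k, d k * t ^ k = ∑ k ∈ Finset.range N, d k * t ^ k
          + (powerSum (tailCoeff d N) t).re := by
        rw [← (h2.add h1).tsum_eq]
        refine tsum_congr fun k => ?_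
        split_ifs <;> simp
      have h4 : ∑ k ∈ Finset.range N, d k * t ^ k ≤ ∑ k ∈ Finset.range N, d k * r ^ k :=
        Finset.sum_le_sum fun k _ =>
          mul_le_mul_of_nonneg_left (pow_le_pow_left₀ ht.1 ht.2 k) (hd0 k)
      have h5 := hlow t ht.1
      linarith
    have hre : Continuous fun t : ℝ => (powerSum (tailCoeff d N) t).re :=
      Complex.continuous_re.comp hcont
    have h6 := intervalIntegral.integral_mono_on hr
      (associatedWeight_intervalIntegrable w le_rfl hr)
      (Continuous.intervalIntegrable (by fun_prop) 0 r) hpow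
    have h7 : ∫ t in (0 : ℝ)..r, (powerSum (tailCoeff d N) t).re
        = (∫ t in (0 : ℝ)..r, powerSum (tailCoeff d N) t).re :=
      Complex.reCLM.intervalIntegral_comp_comm (hcont.intervalIntegrable 0 r)
    have h8 : (∫ t in (0 : ℝ)..r, powerSum (tailCoeff d N) t).re ≤ ‖T (G N)‖ * u r := by
      have h9 := (T (G N)).norm_apply_le (r : ℂ)
      have h10 : T (G N) (r : ℂ) = ∫ t in (0 : ℝ)..r, powerSum (tailCoeff d N) t :=
        (hT _ _).trans (integrationOp_ofReal _ _)
      rw [h10, Complex.norm_real, Real.norm_of_nonneg hr] at h9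
      exact (Complex.re_le_norm _).trans h9
    rw [intervalIntegral.integral_add (intervalIntegrable_const)
      ((hre.intervalIntegrable 0 r).const_mul 8), intervalIntegral.integral_const,
      intervalIntegral.integral_const_mul, h7, sub_zero, smul_eq_mul] at h6
    have h11 : ∑ k ∈ Finset.range N, d k * r ^ (k + 1)
        = r * ∑ k ∈ Finset.range N, d k * r ^ k := by
      rw [Finset.mul_sum]
      exact Finset.sum_congr rfl fun k _ => by ring
    rw [h11]
    linarith
  refine tendsto_order.2 ⟨fun a ha => ?_, fun ε hε => ?_⟩
  · filter_upwards [eventually_ge_atTop (0 : ℝ)] with r hr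
    have h1 := u.pos' r hr
    have h2 := integral_associatedWeight_nonneg (w := w) hr
    exact ha.trans_le (by positivity)
  -- Two contributions, each below `8 * (ε / 16) * u r`, add up to less than `ε * u r`.
  · obtain ⟨N, hN⟩ := hsmall (ε / 16) (by positivity)
    have hpoly : Tendsto (fun r : ℝ => ∑ k ∈ Finset.range N, d k * (r ^ (k + 1) / u r))
        atTop (𝓝 0) := by
      have := tendsto_finsetSum (Finset.range N) fun k _ =>
        (u.tendsto_pow_div (k + 1)).const_mul (d k)
      simpa using this
    filter_upwards [hpoly.eventually_lt_const (show 0 < ε / 16 by positivity),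
      eventually_ge_atTop (0 : ℝ)] with r h1 hr
    have hur := u.pos' r hr
    have h2 : ∑ k ∈ Finset.range N, d k * r ^ (k + 1)
        = (∑ k ∈ Finset.range N, d k * (r ^ (k + 1) / u r)) * u r := by
      rw [Finset.sum_mul]
      exact Finset.sum_congr rfl fun k _ => by field_simp
    have h3 := hsplit N r hr
    rw [h2] at h3
    rw [one_div, inv_mul_lt_iff₀ hur]
    nlinarith [mul_lt_mul_of_pos_right h1 hur, mul_lt_mul_of_pos_right hN hur]

end Necessity

theorem theorem1 (w u : Weight) :
    Tendsto (fun r : ℝ => 1 / u r * ∫ t in (0 : ℝ)..r, associatedWeight w t) atTop (𝓝 0) ↔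
      ∃ T : GrowthSpace w →L[ℂ] GrowthSpace u,
        (∀ (f : GrowthSpace w) (z : ℂ), T f z = integrationOp f z) ∧ IsCompactOperator T :=
  ⟨exists_isCompactOperator_of_tendsto, fun ⟨_, hT, hc⟩ => tendsto_of_isCompactOperator hT hc⟩
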